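/- Let $\Theta$ be a Polish metric space with its Borel $\sigma$-algebra, $\mathbb{Y}$ a measurable (e.g. Polish) space, $H$ a locally finite measure on $\Theta$ (i.e. finite on bounded sets), $\ell$ a $\sigma$-finite measure on $\mathbb{Y}$, $K:\mathbb{Y}\times\Theta\to[0,\infty)$ measurable, and $(\kappa_t)_{t\ge1}$ a deterministic sequence in $[0,\infty)$. Write $\mathrm{BM}_+(\Theta)$ for the measurable nonnegative bounded functions on $\Theta$ with bounded support. A random locally finite measure $W$ is a gamma random measure $\mathrm{GaP}(H,b)$, $b>0$, if $\mathrm{E}\,e^{-\int f\,\mathrm{d}W}=\exp\big(-\int\log(1+f/b)\,\mathrm{d}H\big)$ for all $f\in\mathrm{BM}_+(\Theta)$, and a noncentral gamma random measure $\mathrm{NcGaP}(H,M,c^{-1})$ if $\mathrm{E}\,e^{-\int f\,\mathrm{d}W}=\exp\big(-\int\log(1+cf)\,\mathrm{d}H-\int\frac{cf}{1+cf}\,\mathrm{d}M\big)$ for all $f\in\mathrm{BM}_+(\Theta)$. Let $(W_t)_{t\ge1}$ be an M-ARG(1) process, i.e. a Markov process of random locally finite measures on $\Theta$ with $W_{t+1}\mid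 W_t\sim\mathrm{NcGaP}(H,\beta_{t+1}W_t,c_{t+1}^{-1})$, where $\beta_t,c_t>0$ for $t\ge2$, and let $(N_t)_{t\ge1}$ be the associated shot noise process SN-M-ARG(1): conditionally on $W_t$, $N_t$ is a Poisson random measure on $\mathbb{Y}$ with mean measure $\Lambda_t(\mathrm{d}y)=\kappa_t\big(\int_\Theta K(y,\theta)\,W_t(\mathrm{d}\theta)\big)\ell(\mathrm{d}y)$. Assume time stationarity: $c_t=c$ and $\beta_t=\beta$ for all $t\ge2$, $\rho=\beta c<1$, and $W_1\sim\mathrm{GaP}(H,(1-\rho)/c)$. Let $B\subset\mathbb{Y}$ be measurable, $m\ge1$ an integer, put $K(B,\theta)=\int_B K(y,\theta)\,\ell(\mathrm{d}y)$, and assume that $$J_r(B)=\frac{\Gamma(r)\,c^r}{(1-\rho)^r}\int_\Theta K(B,\theta)^r\,H(\mathrm{d}\theta)<+\infty,\qquad r=1,\dots,m.$$ Then, for every $t\ge1$, $\mathrm{E}(N_t(B)^m)$ is finite and $$\mathrm{E}\big(N_t(B)^m\big)=\sum_{j=1}^m S_{m,j}\,\kappa_t^j\sum_{\substack{\ell_1,\dots,\ell_j\ge0\\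 \sum_{r=1}^j r\ell_r=j}}c(\ell_1,\dots,\ell_j)\prod_{r=1}^jJ_r(B)^{\ell_r},$$ where $c(\ell_1,\dots,\ell_j)=j!\,\big(\prod_{r=1}^j(r!)^{\ell_r}\,\ell_r!\big)^{-1}$ and $S_{m,j}$ are the Stirling numbers of the second kind. -/

import Mathlib

open MeasureTheory ProbabilityTheory Filter
open scoped NNReal ENNReal Nat

noncomputable section

/-- Locally finite measures on a metric space: sets of bounded diameter have finite mass. -/
def BoundedlyFinite {X : Type*} [PseudoMetricSpace X] [MeasurableSpace X] (μ : Measure X) : Prop :=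
  ∀ A : Set X, Bornology.IsBounded A → μ A < ∞

/-- `BM₊(X)`: measurable nonnegative bounded functions with bounded support. -/
def BMPlus (X : Type*) [PseudoMetricSpace X] [MeasurableSpace X] : Set (X → ℝ≥0) :=
  {f | Measurable f ∧ (∃ C : ℝ≥0, ∀ x, f x ≤ C) ∧ Bornology.IsBounded (Function.support f)}

/-- A random locally finite measure on `X`, defined on the probability space `(Ω, P)`
(measurability is with respect to the σ-algebra generated by the evaluations `μ ↦ μ A`). -/
structure IsRandomLocFinMeasure {Ω X : Type*} [MeasurableSpace Ω] [PseudoMetricSpace X]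
    [MeasurableSpace X] (P : Measure Ω) (M : Ω → Measure X) : Prop where
  measurable : Measurable M
  locFinite : ∀ᵐ ω ∂P, BoundedlyFinite (M ω)

/-- `M ∼ GaP(H, b)`: gamma random measure with base measure `H` and rate (inverse scale) `b`. -/
structure IsGammaRandomMeasure {Ω X : Type*} [MeasurableSpace Ω] [PseudoMetricSpace X]
    [MeasurableSpace X] (P : Measure Ω) (M : Ω → Measure X) (H : Measure X) (b : ℝ) : Prop where
  random : IsRandomLocFinMeasure P M
  laplace : ∀ f ∈ BMPlus X,
    ∫ ω, Real.exp (-∫ x, (f x : ℝ) ∂(M ω)) ∂P = Real.exp (-∫ x, Real.log (1 + f x / b) ∂H)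

/-- The Laplace functional of the noncentral gamma random measure `NcGaP(H, M, c⁻¹)`. -/
def ncGammaLaplace {X : Type*} [MeasurableSpace X] (H M : Measure X) (c : ℝ) (f : X → ℝ≥0) : ℝ :=
  Real.exp (-(∫ x, Real.log (1 + c * f x) ∂H) - ∫ x, c * f x / (1 + c * f x) ∂M)

/-- `(W t)_{t ≥ 1} ∼ M-ARG(1)` with base measure `H` and parameters `(β t, c t)_{t ≥ 2}`: a Markov
process of random locally finite measures such that, given `W t`, the law of `W (t+1)` is
`NcGaP(H, β (t+1) W t, (c (t+1))⁻¹)`. Time starts at `1`; the values at smaller indices of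
`W`, `β`, `c` play no role. -/
structure IsMARG {Ω X : Type*} [MeasurableSpace Ω] [PseudoMetricSpace X] [MeasurableSpace X]
    (P : Measure Ω) (H : Measure X) (β c : ℕ → ℝ) (W : ℕ → Ω → Measure X) : Prop where
  base_locFinite : BoundedlyFinite H
  β_pos : ∀ t, 2 ≤ t → 0 < β t
  c_pos : ∀ t, 2 ≤ t → 0 < c t
  random : ∀ t, 1 ≤ t → IsRandomLocFinMeasure P (W t)
  markov : ∀ t, 1 ≤ t → ∀ A : Set (Measure X), MeasurableSet A →
    P⟦W (t + 1) ⁻¹' A | ⨆ s ∈ Set.Icc 1 t, MeasurableSpace.comap (W s) inferInstance⟧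
      =ᵐ[P] P⟦W (t + 1) ⁻¹' A | MeasurableSpace.comap (W t) inferInstance⟧
  transition : ∀ t, 1 ≤ t → ∀ f ∈ BMPlus X,
    P[fun ω => Real.exp (-∫ x, (f x : ℝ) ∂(W (t + 1) ω)) |
        MeasurableSpace.comap (W t) inferInstance]
      =ᵐ[P] fun ω => ncGammaLaplace H (ENNReal.ofReal (β (t + 1)) • W t ω) (c (t + 1)) f

/-- The Poisson law with mean `a ∈ [0, ∞]`, as a law on `[0, ∞]`; for `a = ∞` it is the point mass
at `∞`. -/
def poissonLaw (a : ℝ≥0∞) : Measure ℝ≥0∞ :=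
  if a = ∞ then Measure.dirac ∞ else (poissonMeasure a.toNNReal).map (fun n : ℕ => (n : ℝ≥0∞))

/-- Given the σ-algebra `m`, the random measure `N` is a Poisson random measure with the (random)
mean measure `Λ`: conditionally on `m`, the masses that `N` gives to pairwise disjoint measurable
sets `B i` are independent and Poisson distributed with means `Λ (B i)`. -/
structure IsPoissonGiven {Ω Y : Type*} [mΩ : MeasurableSpace Ω] [MeasurableSpace Y]
    (P : Measure Ω) (m : MeasurableSpace Ω) (N Λ : Ω → Measure Y) : Prop where
  measurable : Measurable[mΩ] N
  cond_law : ∀ (k : ℕ) (B : Fin k → Set Y), (∀ i, MeasurableSet (B i)) →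
    (∀ i j, i ≠ j → Disjoint (B i) (B j)) →
    ∀ E : Fin k → Set ℝ≥0∞, (∀ i, MeasurableSet (E i)) →
      P⟦{ω | ∀ i, N ω (B i) ∈ E i} | m⟧
        =ᵐ[P] fun ω => ∏ i, (poissonLaw (Λ ω (B i)) (E i)).toReal

/-- The intensity measure `Λ(dy) = k λ(y) ℓ(dy)` with `λ(y) = ∫ K(y, θ) w(dθ)`. -/
def shotNoiseIntensity {Y X : Type*} [MeasurableSpace Y] [MeasurableSpace X] (ℓ : Measure Y)
    (K : Y → X → ℝ≥0) (k : ℝ≥0) (w : Measure X) : Measure Y :=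
  (k : ℝ≥0∞) • ℓ.withDensity (fun y => ∫⁻ θ, (K y θ : ℝ≥0∞) ∂w)

/-- `(N t)_{t ≥ 1} ∼ SN-M-ARG(1)`, driven by the M-ARG(1) process `(W t)_{t ≥ 1}`. -/
structure IsSNMARG {Ω Y X : Type*} [MeasurableSpace Ω] [MeasurableSpace Y] [PseudoMetricSpace X]
    [MeasurableSpace X] (P : Measure Ω) (H : Measure X) (β c : ℕ → ℝ) (ℓ : Measure Y)
    (K : Y → X → ℝ≥0) (κ : ℕ → ℝ≥0) (W : ℕ → Ω → Measure X) (N : ℕ → Ω → Measure Y) : Prop where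
  marg : IsMARG P H β c W
  kernel_measurable : Measurable (Function.uncurry K)
  poisson : ∀ t, 1 ≤ t → IsPoissonGiven P (MeasurableSpace.comap (W t) inferInstance) (N t)
    (fun ω => shotNoiseIntensity ℓ K (κ t) (W t ω))

/-- Time stationarity: constant parameters `c₀`, `β₀` with `ρ = β₀ c₀ < 1`, and
`W 1 ∼ GaP(H, (1 - ρ) / c₀)`. -/
structure IsTimeStationary {Ω X : Type*} [MeasurableSpace Ω] [PseudoMetricSpace X]
    [MeasurableSpace X] (P : Measure Ω) (H : Measure X) (β c : ℕ → ℝ) (W : ℕ → Ω → Measure X)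
    (β₀ c₀ : ℝ) : Prop where
  c_const : ∀ t, 2 ≤ t → c t = c₀
  β_const : ∀ t, 2 ≤ t → β t = β₀
  rho_lt_one : β₀ * c₀ < 1
  initial : IsGammaRandomMeasure P (W 1) H ((1 - β₀ * c₀) / c₀)

/-- `J_r(B) = Γ(r) c^r (1 - ρ)^(-r) ∫ K(B, θ)^r H(dθ)` with `ρ = β c` and
`K(B, θ) = ∫_B K(y, θ) ℓ(dy)`, as an element of `[0, ∞]`. -/
def momentJ {Y X : Type*} [MeasurableSpace Y] [MeasurableSpace X] (H : Measure X) (ℓ : Measure Y)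
    (K : Y → X → ℝ≥0) (β c : ℝ) (B : Set Y) (r : ℕ) : ℝ≥0∞ :=
  ENNReal.ofReal (Real.Gamma r * c ^ r / (1 - β * c) ^ r) *
    ∫⁻ θ, (∫⁻ y in B, (K y θ : ℝ≥0∞) ∂ℓ) ^ r ∂H

/-- The vectors `(ℓ_1, …, ℓ_j)` of nonnegative integers with `∑ r ℓ_r = j`; the entry `ℓ_r` is
`l i` for `r = i + 1`, and the bound `ℓ_r ≤ j` is automatic. -/
def partitionVectors (j : ℕ) : Finset (Fin j → ℕ) :=
  (Fintype.piFinset fun _ => Finset.range (j + 1)).filter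
    fun l => ∑ i : Fin j, ((i : ℕ) + 1) * l i = j

theorem mem_partitionVectors {j : ℕ} {l : Fin j → ℕ} :
    l ∈ partitionVectors j ↔ ∑ i : Fin j, ((i : ℕ) + 1) * l i = j := by
  simp only [partitionVectors, Finset.mem_filter, Fintype.mem_piFinset, Finset.mem_range,
    and_iff_right_iff_imp]
  intro h i
  have h1 : ((i : ℕ) + 1) * l i ≤ ∑ i : Fin j, ((i : ℕ) + 1) * l i :=
    Finset.single_le_sum (f := fun i : Fin j => ((i : ℕ) + 1) * l i)
      (fun _ _ => Nat.zero_le _) (Finset.mem_univ i)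
  nlinarith [Nat.zero_le ((i : ℕ) * l i)]

/-- `c(ℓ_1, …, ℓ_j) = j! (∏ r!^{ℓ_r} ℓ_r!)⁻¹`. -/
def partitionCoeff {j : ℕ} (l : Fin j → ℕ) : ℝ≥0∞ :=
  (j ! : ℝ≥0∞) * (∏ i : Fin j, (((i : ℕ) + 1)! : ℝ≥0∞) ^ l i * ((l i)! : ℝ≥0∞))⁻¹

end

/-! Write G(θ) = K(B,θ), X = ∫ G dW_t and b = (1-ρ)/c. Given W_t, the count N_t(B) is Poisson with
mean κ_t X. The j-th factorial moment of a Poisson law of mean a is a^j, and expanding n^m in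
falling factorials produces the numbers S_{m,j}. Hence E N_t(B)^m = ∑ S_{m,j} κ_t^j E X^j, and it
remains to find E X^j.

The law GaP(H,b) is invariant under the transition (`IsMARG.isGammaRandomMeasure`), so W_t has it
for every t. Formally log E e^{sX} = -∫ log(1 - sG/b) dH, so the cumulants of X are (r-1)! ∫ (G/b)^r
dH = J_r. Differentiating the Laplace transform, whose derivative is itself times the derivative of
its logarithm, gives the recursion E X^{k+1} = ∑ binom(k,i) E X^i J_{k-i+1}. Its solution is the
complete Bell polynomial in the J_r (`eq_factorial_mul_bellSum`), which is the sum over partition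
vectors.

Two obstacles make this formal: moments are not known to be finite, so derivatives at s = 0 are
unavailable, and the Laplace functional is given on BM₊ only, while G is an arbitrary measurable
function. The recursion is therefore proved at s < 0 for test functions in BM₊, then carried to s =
0 and to general G by two monotone limits, both through `iSup_eq_sum_antidiagonal_choose_mul`.
Everything ends as an identity in [0,∞], and finiteness of the moment is read off from its
right-hand side. -/

/-! ### Moments of the Poisson law. -/

theorem Nat.pow_eq_sum_stirlingSecond_mul_descFactorial (n m : ℕ) :
    n ^ m = ∑ j ∈ Finset.range (m + 1), Nat.stirlingSecond m j * n.descFactorial j := by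
  induction m with
  | zero => simp
  | succ m ih =>
    have key : ∀ j, n * n.descFactorial j = n.descFactorial (j + 1) + j * n.descFactorial j := by
      intro j
      rw [Nat.descFactorial_succ]
      rcases le_or_gt j n with h | h
      · rw [← add_mul, Nat.sub_add_cancel h]
      · simp [Nat.descFactorial_of_lt h]
    rw [pow_succ, ih, Finset.sum_mul, Finset.sum_range_succ' _ (m + 1)]
    simp only [Nat.stirlingSecond_succ_succ, Nat.stirlingSecond_succ_zero, zero_mul, add_zero,
      add_mul, Finset.sum_add_distrib]
    -- Shifting the index is free: the term x = 0 vanishes, and so does S(m, m+1).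
    have h2 : ∑ x ∈ Finset.range (m + 1),
          x * (Nat.stirlingSecond m x * n.descFactorial x) =
        ∑ x ∈ Finset.range (m + 1),
          (x + 1) * Nat.stirlingSecond m (x + 1) * n.descFactorial (x + 1) := by
      rw [Finset.sum_range_succ', Finset.sum_range_succ,
        Nat.stirlingSecond_eq_zero_of_lt (Nat.lt_succ_self m)]
      simp [mul_assoc]
    simp only [add_mul, Finset.sum_add_distrib] at h2
    rw [← h2, ← Finset.sum_add_distrib]
    refine Finset.sum_congr rfl fun j _ => ?_
    have := key j
    calc _ = Nat.stirlingSecond m j * (n * n.descFactorial j) := by ring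
      _ = _ := by rw [this]; ring

theorem lintegral_poissonMeasure (r : ℝ≥0) (f : ℕ → ℝ≥0∞) :
    ∫⁻ n, f n ∂(poissonMeasure r) =
      ∑' n : ℕ, ENNReal.ofReal (Real.exp (-r) * r ^ n / (n)!) * f n := by
  simp [poissonMeasure, lintegral_sum_measure, lintegral_smul_measure, lintegral_dirac]

theorem lintegral_descFactorial_poissonMeasure (r : ℝ≥0) (j : ℕ) :
    ∫⁻ n : ℕ, (n.descFactorial j : ℝ≥0∞) ∂(poissonMeasure r) = (r : ℝ≥0∞) ^ j := by
  induction j with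
  | zero => simp
  | succ j ih =>
    rw [lintegral_poissonMeasure] at ih ⊢
    -- The n = 0 term is zero; after the shift, (n+1) cancels against (n+1)! and leaves one factor
    -- r.
    rw [tsum_eq_zero_add' ENNReal.summable]
    simp only [Nat.zero_descFactorial_succ, Nat.cast_zero, mul_zero, zero_add,
      Nat.succ_descFactorial_succ]
    rw [pow_succ', ← ih, ← ENNReal.tsum_mul_left]
    refine tsum_congr fun n => ?_
    rw [Nat.cast_mul, ← mul_assoc, ← mul_assoc]
    congr 1
    rw [← ENNReal.ofReal_coe_nnreal (p := r), ← ENNReal.ofReal_natCast (n + 1),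
      ← ENNReal.ofReal_mul (by positivity), ← ENNReal.ofReal_mul (by positivity)]
    congr 1
    rw [Nat.factorial_succ]
    push_cast
    field_simp
    ring

theorem lintegral_pow_poissonMeasure (r : ℝ≥0) (m : ℕ) :
    ∫⁻ n : ℕ, (n : ℝ≥0∞) ^ m ∂(poissonMeasure r) =
      ∑ j ∈ Finset.range (m + 1), (Nat.stirlingSecond m j : ℝ≥0∞) * (r : ℝ≥0∞) ^ j := by
  have h : ∀ n : ℕ, (n : ℝ≥0∞) ^ m = ∑ j ∈ Finset.range (m + 1),
      (Nat.stirlingSecond m j : ℝ≥0∞) * (n.descFactorial j : ℝ≥0∞) := fun n => by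
    exact_mod_cast Nat.pow_eq_sum_stirlingSecond_mul_descFactorial n m
  simp_rw [h]
  rw [lintegral_finsetSum _ (fun _ _ => Measurable.of_discrete)]
  refine Finset.sum_congr rfl fun j _ => ?_
  rw [lintegral_const_mul _ Measurable.of_discrete, lintegral_descFactorial_poissonMeasure]

theorem lintegral_pow_poissonLaw {a : ℝ≥0∞} (ha : a ≠ ∞) (m : ℕ) :
    ∫⁻ x, x ^ m ∂(poissonLaw a) =
      ∑ j ∈ Finset.range (m + 1), (Nat.stirlingSecond m j : ℝ≥0∞) * a ^ j := by
  rw [poissonLaw, if_neg ha, lintegral_map (by fun_prop) Measurable.of_discrete,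
    lintegral_pow_poissonMeasure, ENNReal.coe_toNNReal ha]

instance isProbabilityMeasure_poissonLaw (a : ℝ≥0∞) : IsProbabilityMeasure (poissonLaw a) := by
  rw [poissonLaw]
  split_ifs
  · infer_instance
  · exact Measure.isProbabilityMeasure_map Measurable.of_discrete.aemeasurable

theorem poissonLaw_compl_range_natCast {a : ℝ≥0∞} (ha : a ≠ ∞) :
    poissonLaw a (Set.range ((↑) : ℕ → ℝ≥0∞))ᶜ = 0 := by
  rw [poissonLaw, if_neg ha,
    Measure.map_apply Measurable.of_discrete (Set.countable_range _).measurableSet.compl]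
  convert measure_empty (μ := poissonMeasure a.toNNReal)
  ext n
  simp

/-- A measure on `[0, ∞]` carried by the natural numbers integrates as a series. -/
theorem lintegral_eq_tsum_of_compl_range_natCast {μ : Measure ℝ≥0∞}
    (hμ : μ (Set.range ((↑) : ℕ → ℝ≥0∞))ᶜ = 0) (f : ℝ≥0∞ → ℝ≥0∞) :
    ∫⁻ x, f x ∂μ = ∑' n : ℕ, f n * μ {(n : ℝ≥0∞)} := by
  have hr : μ.restrict (Set.range ((↑) : ℕ → ℝ≥0∞)) = μ :=
    Measure.restrict_eq_self_of_ae_mem (by rwa [ae_iff])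
  rw [← hr, lintegral_countable _ (Set.countable_range _), hr,
    ← (Equiv.ofInjective _ Nat.cast_injective).tsum_eq]
  rfl

/-! ### Moments of a conditionally Poisson random measure. -/

/-- Tower property for the one-set family {B}. Measurability in ω comes from a.e. equality with a
conditional expectation. -/
theorem IsPoissonGiven.measure_preimage {Ω Y : Type*} {m : MeasurableSpace Ω} [mΩ : MeasurableSpace Ω]
    [MeasurableSpace Y] {P : Measure Ω} [IsProbabilityMeasure P]
    (hm : m ≤ mΩ) {N Λ : Ω → Measure Y} (h : IsPoissonGiven P m N Λ) {B : Set Y}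
    (hB : MeasurableSet B) {E : Set ℝ≥0∞} (hE : MeasurableSet E) :
    AEMeasurable (fun ω => poissonLaw (Λ ω B) E) P ∧
      P ((fun ω => N ω B) ⁻¹' E) = ∫⁻ ω, poissonLaw (Λ ω B) E ∂P := by
  have hs : MeasurableSet ((fun ω => N ω B) ⁻¹' E) :=
    ((Measure.measurable_coe hB).comp h.measurable) hE
  have hc := h.cond_law 1 (fun _ => B) (fun _ => hB)
    (fun i j hij => absurd (Subsingleton.elim i j) hij) (fun _ => E) (fun _ => hE)
  simp only [Finset.univ_unique, Finset.prod_singleton, forall_const] at hc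
  change P[((fun ω => N ω B) ⁻¹' E).indicator (fun _ => (1 : ℝ)) | m] =ᵐ[P] _ at hc
  have hint : Integrable (fun ω => (poissonLaw (Λ ω B) E).toReal) P :=
    integrable_condExp.congr hc
  have hE' : ∀ ω, ENNReal.ofReal (poissonLaw (Λ ω B) E).toReal = poissonLaw (Λ ω B) E :=
    fun ω => ENNReal.ofReal_toReal (measure_ne_top _ _)
  constructor
  · simpa only [hE'] using hint.1.aemeasurable.ennreal_ofReal
  · calc P ((fun ω => N ω B) ⁻¹' E)
        = ENNReal.ofReal (P.real ((fun ω => N ω B) ⁻¹' E)) :=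
          (ofReal_measureReal (measure_ne_top _ _)).symm
      _ = ENNReal.ofReal (∫ ω, (poissonLaw (Λ ω B) E).toReal ∂P) := by
          rw [← integral_congr_ae hc, integral_condExp hm, integral_indicator_const _ hs]
          simp
      _ = _ := by
          rw [ofReal_integral_eq_lintegral_ofReal hint (ae_of_all _ fun _ => ENNReal.toReal_nonneg)]
          simp only [hE']

/-- Conditional laws are known one event at a time. Since N(B) is a.s. a natural number, the
countably many events {N(B) = n} suffice, and no regular conditional distribution has to be built.
-/
theorem IsPoissonGiven.lintegral_pow {Ω Y : Type*} {m : MeasurableSpace Ω} [mΩ : MeasurableSpace Ω]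
    [MeasurableSpace Y] {P : Measure Ω} [IsProbabilityMeasure P]
    (hm : m ≤ mΩ) {N Λ : Ω → Measure Y} (h : IsPoissonGiven P m N Λ) {B : Set Y}
    (hB : MeasurableSet B) (hfin : ∀ᵐ ω ∂P, Λ ω B ≠ ∞) (k : ℕ) :
    ∫⁻ ω, (N ω B) ^ k ∂P =
      ∫⁻ ω, ∑ j ∈ Finset.range (k + 1), (Nat.stirlingSecond k j : ℝ≥0∞) * (Λ ω B) ^ j ∂P := by
  have hN : Measurable (fun ω => N ω B) := (Measure.measurable_coe hB).comp h.measurable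
  have hcompl : P.map (fun ω => N ω B) (Set.range ((↑) : ℕ → ℝ≥0∞))ᶜ = 0 := by
    rw [Measure.map_apply hN (Set.countable_range _).measurableSet.compl,
      (h.measure_preimage hm hB (Set.countable_range _).measurableSet.compl).2]
    refine (lintegral_congr_ae ?_).trans lintegral_zero
    filter_upwards [hfin] with ω hω using poissonLaw_compl_range_natCast hω
  have h1 : ∫⁻ ω, (N ω B) ^ k ∂P = ∫⁻ x, x ^ k ∂(P.map (fun ω => N ω B)) :=
    (lintegral_map (f := fun x => x ^ k) (by fun_prop) hN).symm
  rw [h1, lintegral_eq_tsum_of_compl_range_natCast hcompl]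
  have h2 : ∀ n : ℕ, P.map (fun ω => N ω B) {(n : ℝ≥0∞)} =
      ∫⁻ ω, poissonLaw (Λ ω B) {(n : ℝ≥0∞)} ∂P := fun n => by
    rw [Measure.map_apply hN (measurableSet_singleton _),
      (h.measure_preimage hm hB (measurableSet_singleton _)).2]
  have h3 : ∀ n : ℕ, AEMeasurable (fun ω => poissonLaw (Λ ω B) {(n : ℝ≥0∞)}) P :=
    fun n => (h.measure_preimage hm hB (measurableSet_singleton _)).1
  simp_rw [h2]
  rw [tsum_congr fun n : ℕ => (lintegral_const_mul'' ((n : ℝ≥0∞) ^ k) (h3 n)).symm,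
    ← lintegral_tsum fun n => (h3 n).const_mul _]
  refine lintegral_congr_ae ?_
  filter_upwards [hfin] with ω hω
  rw [← lintegral_pow_poissonLaw hω,
    lintegral_eq_tsum_of_compl_range_natCast (poissonLaw_compl_range_natCast hω)]

/-! ### Differentiating the Laplace transform at negative arguments. -/

/-- Pascal's rule, as in the Leibniz formula: this is the induction step for the derivatives of the
product of `a 0` and `b 0`. -/
theorem HasDerivAt.sum_antidiagonal_choose_mul {a b : ℕ → ℝ → ℝ} {t : ℝ}
    (ha : ∀ k, HasDerivAt (a k) (a (k + 1) t) t) (hb : ∀ k, HasDerivAt (b k) (b (k + 1) t) t)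
    (n : ℕ) :
    HasDerivAt
      (fun s => ∑ ij ∈ Finset.HasAntidiagonal.antidiagonal n, (n.choose ij.1 : ℝ) * (a ij.1 s * b ij.2 s))
      (∑ ij ∈ Finset.HasAntidiagonal.antidiagonal (n + 1),
        ((n + 1).choose ij.1 : ℝ) * (a ij.1 t * b ij.2 t)) t := by
  rw [Finset.sum_antidiagonal_choose_succ_mul fun i j => a i t * b j t, ← Finset.sum_add_distrib]
  refine HasDerivAt.fun_sum fun ij hij => ?_
  rw [← Nat.choose_symm_of_eq_add (Finset.HasAntidiagonal.mem_antidiagonal.1 hij).symm, ← mul_add]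
  refine HasDerivAt.const_mul _ ?_
  rw [add_comm]
  exact (ha ij.1).mul (hb ij.2)

/-- If `a` and `b` are sequences of successive derivatives and `a 1 = a 0 * b 0`, then the terms
of `a` satisfy the recursion between moments and cumulants. -/
theorem eq_sum_antidiagonal_choose_mul_of_hasDerivAt {a b : ℕ → ℝ → ℝ} {U : Set ℝ}
    (hU : IsOpen U) (ha : ∀ t ∈ U, ∀ k, HasDerivAt (a k) (a (k + 1) t) t)
    (hb : ∀ t ∈ U, ∀ k, HasDerivAt (b k) (b (k + 1) t) t)
    (h0 : ∀ t ∈ U, a 1 t = a 0 t * b 0 t) (n : ℕ) :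
    ∀ t ∈ U, a (n + 1) t =
      ∑ ij ∈ Finset.HasAntidiagonal.antidiagonal n, (n.choose ij.1 : ℝ) * (a ij.1 t * b ij.2 t) := by
  induction n with
  | zero => intro t ht; simpa using h0 t ht
  | succ n ih =>
    intro t ht
    refine (ha t ht (n + 1)).unique ?_
    refine (HasDerivAt.sum_antidiagonal_choose_mul (ha t ht) (hb t ht) n).congr_of_eventuallyEq ?_
    filter_upwards [hU.mem_nhds ht] with s hs using ih s hs

theorem mem_interior_integrableExpSet_of_neg {Ω : Type*} [MeasurableSpace Ω] {P : Measure Ω}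
    [IsProbabilityMeasure P] {X : Ω → ℝ} (hX : Measurable X) (h0 : ∀ ω, 0 ≤ X ω) {t : ℝ}
    (ht : t < 0) : t ∈ interior (integrableExpSet X P) := by
  have hsub : Set.Iio (0 : ℝ) ⊆ integrableExpSet X P := fun s hs => by
    refine (integrable_const (1 : ℝ)).mono' (Measurable.aestronglyMeasurable (by fun_prop))
      (ae_of_all _ fun ω => ?_)
    rw [Real.norm_of_nonneg (Real.exp_pos _).le, Real.exp_le_one_iff]
    exact mul_nonpos_of_nonpos_of_nonneg (Set.mem_Iio.1 hs).le (h0 ω)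
  exact interior_mono hsub (by rwa [interior_Iio])

theorem hasDerivAt_integral_pow_mul_exp_of_neg {Ω : Type*} [MeasurableSpace Ω] {P : Measure Ω}
    [IsProbabilityMeasure P] {X : Ω → ℝ} (hX : Measurable X) (h0 : ∀ ω, 0 ≤ X ω) {t : ℝ}
    (ht : t < 0) (k : ℕ) :
    HasDerivAt (fun s => ∫ ω, X ω ^ k * Real.exp (s * X ω) ∂P)
      (∫ ω, X ω ^ (k + 1) * Real.exp (t * X ω) ∂P) t :=
  hasDerivAt_integral_pow_mul_exp_real (mem_interior_integrableExpSet_of_neg hX h0 ht) k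

section GammaExponent

variable {Θ : Type*} [MeasurableSpace Θ] {H : Measure Θ} {g : Θ → ℝ} {C : ℝ}

theorem div_one_sub_mul_nonneg {x s : ℝ} (hx : 0 ≤ x) (hs : s ≤ 0) : 0 ≤ x / (1 - s * x) :=
  div_nonneg hx (by nlinarith)

theorem div_one_sub_mul_le {x s : ℝ} (hx : 0 ≤ x) (hs : s ≤ 0) : x / (1 - s * x) ≤ x :=
  div_le_self hx (by nlinarith)

theorem hasDerivAt_div_one_sub_mul_pow {x s : ℝ} (hx : 0 ≤ x) (hs : s ≤ 0) (k : ℕ) :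
    HasDerivAt (fun s => (x / (1 - s * x)) ^ (k + 1))
      (((k : ℝ) + 1) * (x / (1 - s * x)) ^ (k + 2)) s := by
  have h1 : 1 - s * x ≠ 0 := by nlinarith
  have h2 : HasDerivAt (fun s => 1 - s * x) (-x) s := by
    simpa using ((hasDerivAt_id s).mul_const x).const_sub 1
  refine (((hasDerivAt_const s x).fun_div h2 h1).fun_pow (k + 1)).congr_deriv ?_
  rw [add_tsub_cancel_right, pow_add (x / (1 - s * x)) k 2]
  push_cast
  field_simp
  ring

theorem integrable_pow_succ_of_le (hg : Integrable g H) (h0 : ∀ θ, 0 ≤ g θ) (hC : ∀ θ, g θ ≤ C)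
    (k : ℕ) : Integrable (fun θ => g θ ^ (k + 1)) H := by
  refine (hg.const_mul (C ^ k)).mono' (hg.1.pow _) (ae_of_all _ fun θ => ?_)
  rw [Real.norm_of_nonneg (pow_nonneg (h0 θ) _), pow_succ]
  gcongr
  · exact h0 θ
  · exact h0 θ
  · exact hC θ

/-- The s-derivative of g/(1-sg) is its square, and 0 ≤ g/(1-sg) ≤ g for s ≤ 0. Powers of g,
integrable because g is bounded, thus dominate uniformly in s < 0. -/
theorem hasDerivAt_integral_div_one_sub_mul_pow (hgm : Measurable g) (hg : Integrable g H)
    (h0 : ∀ θ, 0 ≤ g θ) (hC : ∀ θ, g θ ≤ C) {t : ℝ} (ht : t < 0) (k : ℕ) :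
    HasDerivAt (fun s => (k ! : ℝ) * ∫ θ, (g θ / (1 - s * g θ)) ^ (k + 1) ∂H)
      (((k + 1)! : ℝ) * ∫ θ, (g θ / (1 - t * g θ)) ^ (k + 2) ∂H) t := by
  have hm : ∀ (s : ℝ) (j : ℕ),
      AEStronglyMeasurable (fun θ => (g θ / (1 - s * g θ)) ^ j) H := fun s j =>
    Measurable.aestronglyMeasurable (by fun_prop)
  have h := (hasDerivAt_integral_of_dominated_loc_of_deriv_le (μ := H) (𝕜 := ℝ) (s := Set.Iio 0)
    (F := fun s θ => (g θ / (1 - s * g θ)) ^ (k + 1))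
    (F' := fun s θ => ((k : ℝ) + 1) * (g θ / (1 - s * g θ)) ^ (k + 2))
    (bound := fun θ => ((k : ℝ) + 1) * g θ ^ (k + 2)) (x₀ := t) (Iio_mem_nhds ht)
    (Eventually.of_forall fun s => hm s _)
    ((integrable_pow_succ_of_le hg h0 hC k).mono' (hm t _) (ae_of_all _ fun θ => ?_))
    ((hm t _).const_mul _)
    (ae_of_all _ fun θ s hs => ?_)
    ((integrable_pow_succ_of_le hg h0 hC (k + 1)).const_mul _)
    (ae_of_all _ fun θ s hs => hasDerivAt_div_one_sub_mul_pow (h0 θ) (Set.mem_Iio.1 hs).le k)).2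
  · refine (h.const_mul (k ! : ℝ)).congr_deriv ?_
    rw [integral_const_mul, Nat.factorial_succ]
    push_cast
    ring
  · have := div_one_sub_mul_nonneg (h0 θ) ht.le
    rw [Real.norm_of_nonneg (by positivity)]
    exact pow_le_pow_left₀ this (div_one_sub_mul_le (h0 θ) ht.le) _
  · have hs' := (Set.mem_Iio.1 hs).le
    have := div_one_sub_mul_nonneg (h0 θ) hs'
    rw [Real.norm_of_nonneg (by positivity)]
    gcongr
    exact div_one_sub_mul_le (h0 θ) hs'

theorem integrable_log_one_add_mul (hgm : Measurable g) (hg : Integrable g H)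
    (h0 : ∀ θ, 0 ≤ g θ) {s : ℝ} (hs : 0 ≤ s) :
    Integrable (fun θ => Real.log (1 + s * g θ)) H := by
  refine (hg.const_mul s).mono' (Measurable.aestronglyMeasurable (by fun_prop))
    (ae_of_all _ fun θ => ?_)
  have h1 : 0 ≤ s * g θ := mul_nonneg hs (h0 θ)
  rw [Real.norm_of_nonneg (Real.log_nonneg (by linarith))]
  linarith [Real.log_le_sub_one_of_pos (x := 1 + s * g θ) (by linarith)]

theorem hasDerivAt_integral_log_one_sub_mul (hgm : Measurable g) (hg : Integrable g H)
    (h0 : ∀ θ, 0 ≤ g θ) {t : ℝ} (ht : t < 0) :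
    HasDerivAt (fun s => ∫ θ, Real.log (1 - s * g θ) ∂H)
      (-∫ θ, g θ / (1 - t * g θ) ∂H) t := by
  rw [← integral_neg]
  refine (hasDerivAt_integral_of_dominated_loc_of_deriv_le (μ := H) (𝕜 := ℝ) (s := Set.Iio 0)
    (F := fun s θ => Real.log (1 - s * g θ))
    (F' := fun s θ => -(g θ / (1 - s * g θ)))
    (bound := g) (x₀ := t) (Iio_mem_nhds ht)
    (Eventually.of_forall fun s => Measurable.aestronglyMeasurable (by fun_prop))
    ?_ (Measurable.aestronglyMeasurable (by fun_prop))
    (ae_of_all _ fun θ s hs => ?_) hg (ae_of_all _ fun θ s hs => ?_)).2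
  · simpa [sub_eq_add_neg] using integrable_log_one_add_mul hgm hg h0 (neg_nonneg.2 ht.le)
  · have hs' := (Set.mem_Iio.1 hs).le
    rw [norm_neg, Real.norm_of_nonneg (div_one_sub_mul_nonneg (h0 θ) hs')]
    exact div_one_sub_mul_le (h0 θ) hs'
  · have h1 : 1 - s * g θ ≠ 0 := by nlinarith [h0 θ, Set.mem_Iio.1 hs]
    have h2 : HasDerivAt (fun s => 1 - s * g θ) (-g θ) s := by
      simpa using ((hasDerivAt_id s).mul_const (g θ)).const_sub 1
    exact (h2.log h1).congr_deriv (neg_div _ _)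

theorem integral_pow_mul_exp_eq_sum {Ω : Type*} [MeasurableSpace Ω] {P : Measure Ω}
    [IsProbabilityMeasure P] {X : Ω → ℝ} (hX : Measurable X) (hX0 : ∀ ω, 0 ≤ X ω)
    (hgm : Measurable g) (hg : Integrable g H) (h0 : ∀ θ, 0 ≤ g θ) (hC : ∀ θ, g θ ≤ C)
    (hL : ∀ t < 0, ∫ ω, Real.exp (t * X ω) ∂P = Real.exp (-∫ θ, Real.log (1 - t * g θ) ∂H))
    (n : ℕ) {t : ℝ} (ht : t < 0) :
    ∫ ω, X ω ^ (n + 1) * Real.exp (t * X ω) ∂P =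
      ∑ ij ∈ Finset.HasAntidiagonal.antidiagonal n, (n.choose ij.1 : ℝ) *
        ((∫ ω, X ω ^ ij.1 * Real.exp (t * X ω) ∂P) *
          ((ij.2)! * ∫ θ, (g θ / (1 - t * g θ)) ^ (ij.2 + 1) ∂H)) := by
  refine eq_sum_antidiagonal_choose_mul_of_hasDerivAt
    (a := fun k s => ∫ ω, X ω ^ k * Real.exp (s * X ω) ∂P)
    (b := fun k s => (k ! : ℝ) * ∫ θ, (g θ / (1 - s * g θ)) ^ (k + 1) ∂H) (U := Set.Iio 0)
    isOpen_Iio (fun s hs k => hasDerivAt_integral_pow_mul_exp_of_neg hX hX0 hs k)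
    (fun s hs k => hasDerivAt_integral_div_one_sub_mul_pow hgm hg h0 hC hs k) ?_ n t ht
  -- The first-order relation: the derivative of E e^{sX}, computed once under the expectation and
  -- once from exp(-∫ log(1-sg) dH).
  intro s hs
  have h1 := hasDerivAt_integral_pow_mul_exp_of_neg (P := P) hX hX0 hs 0
  refine h1.unique ?_
  have h2 := (hasDerivAt_integral_log_one_sub_mul hgm hg h0 hs).fun_neg.exp
  simp only [pow_zero, one_mul, Nat.factorial_zero, Nat.cast_one, zero_add, pow_one, neg_neg]
    at h2 ⊢
  rw [hL s hs]
  refine h2.congr_of_eventuallyEq ?_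
  filter_upwards [Iio_mem_nhds hs] with u hu using hL u hu

end GammaExponent

/-! ### First monotone limit: s = -1/(n+1) increasing to 0. -/

theorem ENNReal.iSup_mul_iSup_of_monotone {f g : ℕ → ℝ≥0∞} (hf : Monotone f) (hg : Monotone g) :
    (⨆ n, f n) * ⨆ n, g n = ⨆ n, f n * g n := by
  simp_rw [ENNReal.iSup_mul, ENNReal.mul_iSup]
  refine le_antisymm (iSup_le fun i => iSup_le fun j => ?_)
    (iSup_le fun n => le_iSup_of_le n (le_iSup (fun j => f n * g j) n))
  exact le_iSup_of_le (max i j) (mul_le_mul' (hf (le_max_left i j)) (hg (le_max_right i j)))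

/-- The recursion between moments `M` and cumulants `J` passes to monotone limits. -/
theorem iSup_eq_sum_antidiagonal_choose_mul {M J : ℕ → ℕ → ℝ≥0∞}
    (hM : ∀ k, Monotone fun n => M n k) (hJ : ∀ k, Monotone fun n => J n k) {k : ℕ}
    (h : ∀ n, M n (k + 1) =
      ∑ ij ∈ Finset.HasAntidiagonal.antidiagonal k, (k.choose ij.1 : ℝ≥0∞) * (M n ij.1 * J n ij.2)) :
    ⨆ n, M n (k + 1) = ∑ ij ∈ Finset.HasAntidiagonal.antidiagonal k,
      (k.choose ij.1 : ℝ≥0∞) * ((⨆ n, M n ij.1) * ⨆ n, J n ij.2) := by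
  simp_rw [h]
  rw [← ENNReal.finsetSum_iSup_of_monotone]
  · refine Finset.sum_congr rfl fun ij _ => ?_
    rw [← ENNReal.mul_iSup, ENNReal.iSup_mul_iSup_of_monotone (hM _) (hJ _)]
  · intro ij n n' hn
    dsimp only
    gcongr
    · exact hM _ hn
    · exact hJ _ hn

/-- The weight e^{sX} with s < 0 makes every moment finite; as s increases to 0 the weighted moments
increase to the true one, finite or not. -/
theorem lintegral_pow_eq_iSup_integral_mul_exp {Ω : Type*} [MeasurableSpace Ω] {P : Measure Ω}
    [IsProbabilityMeasure P] {X : Ω → ℝ} (hX : Measurable X) (h0 : ∀ ω, 0 ≤ X ω) (k : ℕ) :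
    (Monotone fun n : ℕ =>
        ENNReal.ofReal (∫ ω, X ω ^ k * Real.exp (-((n : ℝ) + 1)⁻¹ * X ω) ∂P)) ∧
      ∫⁻ ω, ENNReal.ofReal (X ω) ^ k ∂P =
        ⨆ n : ℕ, ENNReal.ofReal (∫ ω, X ω ^ k * Real.exp (-((n : ℝ) + 1)⁻¹ * X ω) ∂P) := by
  have hnn : ∀ (n : ℕ) ω, 0 ≤ X ω ^ k * Real.exp (-((n : ℝ) + 1)⁻¹ * X ω) := fun n ω =>
    mul_nonneg (pow_nonneg (h0 ω) _) (Real.exp_pos _).le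
  have hint : ∀ n : ℕ, Integrable (fun ω => X ω ^ k * Real.exp (-((n : ℝ) + 1)⁻¹ * X ω)) P :=
    fun n => by
    have ht : -((n : ℝ) + 1)⁻¹ < 0 := neg_neg_iff_pos.2 (by positivity)
    exact integrable_pow_mul_exp_of_mem_interior_integrableExpSet
      (mem_interior_integrableExpSet_of_neg hX h0 ht) k
  have heq : ∀ n : ℕ, ENNReal.ofReal (∫ ω, X ω ^ k * Real.exp (-((n : ℝ) + 1)⁻¹ * X ω) ∂P) =
      ∫⁻ ω, ENNReal.ofReal (X ω ^ k * Real.exp (-((n : ℝ) + 1)⁻¹ * X ω)) ∂P := fun n =>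
    ofReal_integral_eq_lintegral_ofReal (hint n) (ae_of_all _ (hnn n))
  have hmono : ∀ ω, Monotone fun n : ℕ =>
      ENNReal.ofReal (X ω ^ k * Real.exp (-((n : ℝ) + 1)⁻¹ * X ω)) := fun ω n n' hn => by
    refine ENNReal.ofReal_le_ofReal (mul_le_mul_of_nonneg_left (Real.exp_le_exp.2 ?_)
      (pow_nonneg (h0 ω) _))
    refine mul_le_mul_of_nonneg_right (neg_le_neg ?_) (h0 ω)
    gcongr
  simp_rw [heq]
  refine ⟨fun n n' hn => lintegral_mono fun ω => hmono ω hn, ?_⟩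
  rw [← lintegral_iSup (fun n => by fun_prop) (fun n n' hn ω => hmono ω hn)]
  refine lintegral_congr fun ω => ((iSup_eq_of_tendsto (hmono ω) ?_).symm)
  rw [← ENNReal.ofReal_pow (h0 ω)]
  refine ENNReal.tendsto_ofReal ?_
  have h1 : Tendsto (fun n : ℕ => ((n : ℝ) + 1)⁻¹) atTop (nhds 0) := by
    simpa using tendsto_one_div_add_atTop_nhds_zero_nat (𝕜 := ℝ)
  have h2 := ((Real.continuous_exp.tendsto _).comp ((h1.neg).mul_const (X ω))).const_mul (X ω ^ k)
  simpa using h2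

theorem lintegral_pow_eq_iSup_integral_div_one_sub_mul {Θ : Type*} [MeasurableSpace Θ]
    {H : Measure Θ} {g : Θ → ℝ} {C : ℝ} (hgm : Measurable g) (hg : Integrable g H)
    (h0 : ∀ θ, 0 ≤ g θ) (hC : ∀ θ, g θ ≤ C) (k : ℕ) :
    (Monotone fun n : ℕ =>
        ENNReal.ofReal (∫ θ, (g θ / (1 - -((n : ℝ) + 1)⁻¹ * g θ)) ^ (k + 1) ∂H)) ∧
      ∫⁻ θ, ENNReal.ofReal (g θ) ^ (k + 1) ∂H =
        ⨆ n : ℕ, ENNReal.ofReal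
          (∫ θ, (g θ / (1 - -((n : ℝ) + 1)⁻¹ * g θ)) ^ (k + 1) ∂H) := by
  have ht : ∀ n : ℕ, -((n : ℝ) + 1)⁻¹ ≤ 0 := fun n => neg_nonpos.2 (by positivity)
  have hnn : ∀ (n : ℕ) θ, 0 ≤ g θ / (1 - -((n : ℝ) + 1)⁻¹ * g θ) := fun n θ =>
    div_one_sub_mul_nonneg (h0 θ) (ht n)
  have hint : ∀ n : ℕ,
      Integrable (fun θ => (g θ / (1 - -((n : ℝ) + 1)⁻¹ * g θ)) ^ (k + 1)) H := fun n => by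
    refine (integrable_pow_succ_of_le hg h0 hC k).mono'
      (Measurable.aestronglyMeasurable (by fun_prop)) (ae_of_all _ fun θ => ?_)
    rw [Real.norm_of_nonneg (pow_nonneg (hnn n θ) _)]
    exact pow_le_pow_left₀ (hnn n θ) (div_one_sub_mul_le (h0 θ) (ht n)) _
  have heq : ∀ n : ℕ,
      ENNReal.ofReal (∫ θ, (g θ / (1 - -((n : ℝ) + 1)⁻¹ * g θ)) ^ (k + 1) ∂H) =
      ∫⁻ θ, ENNReal.ofReal ((g θ / (1 - -((n : ℝ) + 1)⁻¹ * g θ)) ^ (k + 1)) ∂H := fun n =>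
    ofReal_integral_eq_lintegral_ofReal (hint n) (ae_of_all _ fun θ => pow_nonneg (hnn n θ) _)
  have hmono : ∀ θ, Monotone fun n : ℕ =>
      ENNReal.ofReal ((g θ / (1 - -((n : ℝ) + 1)⁻¹ * g θ)) ^ (k + 1)) := fun θ n n' hn => by
    refine ENNReal.ofReal_le_ofReal (pow_le_pow_left₀ (hnn n θ) ?_ _)
    have h1 : ((n' : ℝ) + 1)⁻¹ ≤ ((n : ℝ) + 1)⁻¹ := by gcongr
    refine div_le_div_of_nonneg_left (h0 θ) ?_ ?_
    · nlinarith [ht n', h0 θ]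
    · nlinarith [h0 θ]
  simp_rw [heq]
  refine ⟨fun n n' hn => lintegral_mono fun θ => hmono θ hn, ?_⟩
  rw [← lintegral_iSup (fun n => by fun_prop) (fun n n' hn θ => hmono θ hn)]
  refine lintegral_congr fun θ => ((iSup_eq_of_tendsto (hmono θ) ?_).symm)
  rw [← ENNReal.ofReal_pow (h0 θ)]
  refine ENNReal.tendsto_ofReal (Tendsto.pow ?_ _)
  have h1 : Tendsto (fun n : ℕ => ((n : ℝ) + 1)⁻¹) atTop (nhds 0) := by
    simpa using tendsto_one_div_add_atTop_nhds_zero_nat (𝕜 := ℝ)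
  have h2 := (h1.neg.mul_const (g θ)).const_sub 1
  have h3 : Tendsto (fun n : ℕ => g θ / (1 - -((n : ℝ) + 1)⁻¹ * g θ)) atTop
      (nhds (g θ / (1 - -0 * g θ))) := tendsto_const_nhds.div h2 (by simp)
  simpa using h3

/-- A nonnegative variable whose Laplace transform is that of the integral of `g` against a gamma
random measure has moments that satisfy the recursion with cumulants `k! ∫ g ^ (k + 1) dH`. -/
theorem lintegral_pow_succ_eq_sum_of_laplace {Ω Θ : Type*} [MeasurableSpace Ω] {P : Measure Ω}
    [IsProbabilityMeasure P] [MeasurableSpace Θ] {H : Measure Θ} {g : Θ → ℝ} {C : ℝ} {X : Ω → ℝ}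
    (hX : Measurable X) (hX0 : ∀ ω, 0 ≤ X ω) (hgm : Measurable g) (hg : Integrable g H)
    (h0 : ∀ θ, 0 ≤ g θ) (hC : ∀ θ, g θ ≤ C)
    (hL : ∀ t < 0, ∫ ω, Real.exp (t * X ω) ∂P = Real.exp (-∫ θ, Real.log (1 - t * g θ) ∂H))
    (k : ℕ) :
    ∫⁻ ω, ENNReal.ofReal (X ω) ^ (k + 1) ∂P =
      ∑ ij ∈ Finset.HasAntidiagonal.antidiagonal k, (k.choose ij.1 : ℝ≥0∞) *
        ((∫⁻ ω, ENNReal.ofReal (X ω) ^ ij.1 ∂P) *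
          ((ij.2)! * ∫⁻ θ, ENNReal.ofReal (g θ) ^ (ij.2 + 1) ∂H)) := by
  simp_rw [(lintegral_pow_eq_iSup_integral_mul_exp hX hX0 _).2,
    (lintegral_pow_eq_iSup_integral_div_one_sub_mul hgm hg h0 hC _).2]
  have hfac : ∀ (j : ℕ) (f : ℕ → ℝ≥0∞), (j ! : ℝ≥0∞) * ⨆ n, f n = ⨆ n, (j ! : ℝ≥0∞) * f n :=
    fun _ _ => ENNReal.mul_iSup _ _
  simp_rw [hfac]
  refine iSup_eq_sum_antidiagonal_choose_mul
    (M := fun n k => ENNReal.ofReal (∫ ω, X ω ^ k * Real.exp (-((n : ℝ) + 1)⁻¹ * X ω) ∂P))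
    (J := fun n k => (k ! : ℝ≥0∞) *
      ENNReal.ofReal (∫ θ, (g θ / (1 - -((n : ℝ) + 1)⁻¹ * g θ)) ^ (k + 1) ∂H))
    (fun k => (lintegral_pow_eq_iSup_integral_mul_exp hX hX0 k).1)
    (fun k => ((lintegral_pow_eq_iSup_integral_div_one_sub_mul hgm hg h0 hC k).1).const_mul'
      (k ! : ℝ≥0∞)) fun n => ?_
  have ht : -((n : ℝ) + 1)⁻¹ < 0 := neg_neg_iff_pos.2 (by positivity)
  have h1 : ∀ j, 0 ≤ ∫ ω, X ω ^ j * Real.exp (-((n : ℝ) + 1)⁻¹ * X ω) ∂P := fun j =>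
    integral_nonneg fun ω => mul_nonneg (pow_nonneg (hX0 ω) _) (Real.exp_pos _).le
  have h2 : ∀ j, 0 ≤ ∫ θ, (g θ / (1 - -((n : ℝ) + 1)⁻¹ * g θ)) ^ j ∂H := fun j =>
    integral_nonneg fun θ => pow_nonneg (div_one_sub_mul_nonneg (h0 θ) ht.le) _
  rw [integral_pow_mul_exp_eq_sum hX hX0 hgm hg h0 hC hL k ht, ENNReal.ofReal_sum_of_nonneg]
  · refine Finset.sum_congr rfl fun ij _ => ?_
    rw [ENNReal.ofReal_mul (by positivity), ENNReal.ofReal_mul (h1 _),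
      ENNReal.ofReal_mul (by positivity), ENNReal.ofReal_natCast, ENNReal.ofReal_natCast]
  · intro ij _
    exact mul_nonneg (by positivity) (mul_nonneg (h1 _) (mul_nonneg (by positivity) (h2 _)))

/-! ### Test functions in BM₊ and approximation by them. -/

section BoundedSupport

variable {X : Type*} [PseudoMetricSpace X] [MeasurableSpace X]

theorem BMPlus.integrable {f : X → ℝ≥0} (hf : f ∈ BMPlus X) {μ : Measure X}
    (hμ : BoundedlyFinite μ) : Integrable (fun x => (f x : ℝ)) μ := by
  obtain ⟨hm, ⟨C, hC⟩, hb⟩ := hf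
  have hs : Function.support (fun x => (f x : ℝ)) = Function.support f := by
    ext x; simp
  rw [← integrableOn_iff_integrable_of_support_subset hs.subset]
  refine IntegrableOn.of_bound (hμ _ hb) hm.coe_nnreal_real.aestronglyMeasurable C
    (ae_of_all _ fun x => ?_)
  rw [Real.norm_of_nonneg (f x).coe_nonneg]
  exact hC x

theorem BMPlus.const_mul {f : X → ℝ≥0} (hf : f ∈ BMPlus X) (s : ℝ≥0) :
    (fun x => s * f x) ∈ BMPlus X := by
  obtain ⟨hm, ⟨C, hC⟩, hb⟩ := hf
  refine ⟨hm.const_mul s, ⟨s * C, fun x => mul_le_mul_right (hC x) s⟩, hb.subset fun x hx => ?_⟩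
  exact right_ne_zero_of_mul hx

/-- Every measurable `[0, ∞]`-valued function is an increasing limit of functions in `BM₊`. -/
theorem exists_BMPlus_monotone_iSup_eq [OpensMeasurableSpace X] {G : X → ℝ≥0∞}
    (hG : Measurable G) :
    ∃ f : ℕ → X → ℝ≥0, (∀ n, f n ∈ BMPlus X) ∧ Monotone f ∧
      ∀ x, ⨆ n, (f n x : ℝ≥0∞) = G x := by
  -- The approximants are min(G, n) restricted to the ball of radius n about a fixed point.
  obtain ⟨A, hAm, hAb, hAmono, hAU⟩ : ∃ A : ℕ → Set X, (∀ n, MeasurableSet (A n)) ∧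
      (∀ n, Bornology.IsBounded (A n)) ∧ Monotone A ∧ ∀ x, ∃ n, x ∈ A n := by
    rcases isEmpty_or_nonempty X with h | ⟨⟨x₀⟩⟩
    · exact ⟨fun _ => ∅, fun _ => .empty, fun _ => Bornology.isBounded_empty, monotone_const,
        fun x => isEmptyElim x⟩
    · refine ⟨fun n => Metric.ball x₀ n, fun n => Metric.isOpen_ball.measurableSet,
        fun n => Metric.isBounded_ball, fun n n' h => Metric.ball_subset_ball (by exact_mod_cast h),
        fun x => ?_⟩
      obtain ⟨n, hn⟩ := exists_nat_gt (dist x x₀)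
      exact ⟨n, hn⟩
  have hcoe : ∀ n x, (((A n).indicator (fun x => (min (G x) n).toNNReal) x : ℝ≥0) : ℝ≥0∞) =
      (A n).indicator (fun x => min (G x) n) x := fun n x => by
    by_cases hx : x ∈ A n
    · rw [Set.indicator_of_mem hx, Set.indicator_of_mem hx, ENNReal.coe_toNNReal]
      exact ne_top_of_le_ne_top (ENNReal.natCast_ne_top n) (min_le_right _ _)
    · simp [hx]
  have hmono : ∀ n n', n ≤ n' → ∀ x, (A n).indicator (fun x => min (G x) (n : ℝ≥0∞)) x ≤
      (A n').indicator (fun x => min (G x) (n' : ℝ≥0∞)) x := fun n n' h x =>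
    (Set.indicator_le_indicator_of_subset (hAmono h) (fun _ => zero_le) x).trans
      (Set.indicator_le_indicator (min_le_min_left _ (by exact_mod_cast h)))
  refine ⟨fun n => (A n).indicator fun x => (min (G x) n).toNNReal, fun n => ⟨?_, ⟨n, fun x => ?_⟩,
    (hAb n).subset Set.support_indicator_subset⟩, fun n n' h x => ?_, fun x => ?_⟩
  · exact ((hG.min measurable_const).ennreal_toNNReal).indicator (hAm n)
  · rw [← ENNReal.coe_le_coe, hcoe]
    refine (Set.indicator_le_self _ _ x).trans (by simp)
  · rw [← ENNReal.coe_le_coe, hcoe, hcoe]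
    exact hmono n n' h x
  · simp_rw [hcoe]
    refine le_antisymm (iSup_le fun n => (Set.indicator_le_self _ _ x).trans (min_le_left _ _)) ?_
    obtain ⟨n₀, hn₀⟩ := hAU x
    have h1 : G x = ⨆ n : ℕ, min (G x) n := by
      rw [← inf_iSup_eq, ENNReal.iSup_natCast, inf_top_eq]
    rw [h1]
    refine iSup_le fun n => le_iSup_of_le (max n₀ n) ?_
    rw [Set.indicator_of_mem (hAmono (le_max_left _ _) hn₀)]
    exact min_le_min_left _ (by exact_mod_cast le_max_right n₀ n)

end BoundedSupport

theorem BMPlus.integral_eq_toReal_lintegral {X : Type*} [PseudoMetricSpace X] [MeasurableSpace X]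
    {f : X → ℝ≥0} (hf : f ∈ BMPlus X) (μ : Measure X) :
    ∫ x, (f x : ℝ) ∂μ = (∫⁻ x, (f x : ℝ≥0∞) ∂μ).toReal := by
  rw [integral_eq_lintegral_of_nonneg_ae (ae_of_all _ fun x => (f x).coe_nonneg)
    hf.1.coe_nnreal_real.aestronglyMeasurable]
  simp

theorem BMPlus.lintegral_ne_top {X : Type*} [PseudoMetricSpace X] [MeasurableSpace X]
    {f : X → ℝ≥0} (hf : f ∈ BMPlus X) {μ : Measure X} (hμ : BoundedlyFinite μ) :
    ∫⁻ x, (f x : ℝ≥0∞) ∂μ ≠ ∞ := by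
  have := (BMPlus.integrable hf hμ).lintegral_lt_top
  simpa using this.ne

/-! ### Second monotone limit: from BM₊ to arbitrary measurable integrands. -/

section GammaMoments

variable {Ω X : Type*} [MeasurableSpace Ω] [PseudoMetricSpace X] [MeasurableSpace X]
  {P : Measure Ω} [IsProbabilityMeasure P] {M : Ω → Measure X} {H : Measure X} {b : ℝ}

theorem IsGammaRandomMeasure.lintegral_pow_succ_of_mem_BMPlus (h : IsGammaRandomMeasure P M H b)
    (hb : 0 < b) (hH : BoundedlyFinite H) {f : X → ℝ≥0} (hf : f ∈ BMPlus X) (k : ℕ) :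
    ∫⁻ ω, (∫⁻ x, (f x : ℝ≥0∞) ∂(M ω)) ^ (k + 1) ∂P =
      ∑ ij ∈ Finset.HasAntidiagonal.antidiagonal k, (k.choose ij.1 : ℝ≥0∞) *
        ((∫⁻ ω, (∫⁻ x, (f x : ℝ≥0∞) ∂(M ω)) ^ ij.1 ∂P) *
          ((ij.2)! * ∫⁻ x, ((f x : ℝ≥0∞) / ENNReal.ofReal b) ^ (ij.2 + 1) ∂H)) := by
  have hfm := hf.1
  have hmeas : Measurable fun ω => ∫⁻ x, (f x : ℝ≥0∞) ∂(M ω) :=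
    (Measure.measurable_lintegral hf.1.coe_nnreal_ennreal).comp h.random.measurable
  obtain ⟨C, hC⟩ := hf.2.1
  have key := lintegral_pow_succ_eq_sum_of_laplace (P := P) (H := H) (C := C / b)
    (X := fun ω => (∫⁻ x, (f x : ℝ≥0∞) ∂(M ω)).toReal) (g := fun x => f x / b)
    hmeas.ennreal_toReal (fun ω => ENNReal.toReal_nonneg) (by fun_prop)
    ((BMPlus.integrable hf hH).div_const b) (fun x => by positivity)
    (fun x => by gcongr; exact hC x) ?_ k
  · have h1 : ∀ j, ∫⁻ ω, ENNReal.ofReal (∫⁻ x, (f x : ℝ≥0∞) ∂(M ω)).toReal ^ j ∂P =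
        ∫⁻ ω, (∫⁻ x, (f x : ℝ≥0∞) ∂(M ω)) ^ j ∂P := fun j => by
      refine lintegral_congr_ae ?_
      filter_upwards [h.random.locFinite] with ω hω
      rw [ENNReal.ofReal_toReal (BMPlus.lintegral_ne_top hf hω)]
    have h2 : ∀ x, ENNReal.ofReal (f x / b) = (f x : ℝ≥0∞) / ENNReal.ofReal b := fun x => by
      rw [ENNReal.ofReal_div_of_pos hb, ENNReal.ofReal_coe_nnreal]
    simpa only [h1, h2] using key
  · intro t ht
    -- Testing the Laplace functional on -t f, again in BM₊, gives the Laplace transform of ∫ f dM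
    -- at t.
    have hs : (((-t).toNNReal : ℝ≥0) : ℝ) = -t := Real.coe_toNNReal _ (by linarith)
    have hl := h.laplace _ (BMPlus.const_mul hf (-t).toNNReal)
    simp only [NNReal.coe_mul, hs, integral_const_mul,
      BMPlus.integral_eq_toReal_lintegral hf] at hl
    convert hl using 3
    · ring_nf
    · congr 2
      ext x
      congr 1
      ring

/-- Moments of the integral of a nonnegative function against a gamma random measure. -/
theorem IsGammaRandomMeasure.lintegral_pow_succ [OpensMeasurableSpace X]
    (h : IsGammaRandomMeasure P M H b) (hb : 0 < b) (hH : BoundedlyFinite H) {G : X → ℝ≥0∞}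
    (hG : Measurable G) (k : ℕ) :
    ∫⁻ ω, (∫⁻ x, G x ∂(M ω)) ^ (k + 1) ∂P =
      ∑ ij ∈ Finset.HasAntidiagonal.antidiagonal k, (k.choose ij.1 : ℝ≥0∞) *
        ((∫⁻ ω, (∫⁻ x, G x ∂(M ω)) ^ ij.1 ∂P) *
          ((ij.2)! * ∫⁻ x, (G x / ENNReal.ofReal b) ^ (ij.2 + 1) ∂H)) := by
  obtain ⟨f, hf, hmono, hsup⟩ := exists_BMPlus_monotone_iSup_eq hG
  have hfm : ∀ n, Measurable fun x => (f n x : ℝ≥0∞) := fun n => (hf n).1.coe_nnreal_ennreal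
  have hcmono : ∀ x, Monotone fun n => (f n x : ℝ≥0∞) := fun x n n' hn =>
    ENNReal.coe_le_coe.2 (hmono hn x)
  have hpow : ∀ {u : ℕ → ℝ≥0∞} (_ : Monotone u) (k : ℕ), (⨆ n, u n) ^ k = ⨆ n, u n ^ k :=
    fun {u} hu k => (iSup_eq_of_tendsto (fun n n' hn => pow_le_pow_left' (hu hn) k)
      (ENNReal.Tendsto.pow (tendsto_atTop_iSup hu))).symm
  have hIm : ∀ n, Measurable fun ω => ∫⁻ x, (f n x : ℝ≥0∞) ∂(M ω) := fun n =>
    (Measure.measurable_lintegral (hfm n)).comp h.random.measurable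
  have hImono : ∀ ω, Monotone fun n => ∫⁻ x, (f n x : ℝ≥0∞) ∂(M ω) := fun ω n n' hn =>
    lintegral_mono fun x => hcmono x hn
  have hI : ∀ ω, ∫⁻ x, G x ∂(M ω) = ⨆ n, ∫⁻ x, (f n x : ℝ≥0∞) ∂(M ω) := fun ω => by
    simp_rw [← hsup]
    exact lintegral_iSup hfm fun n n' hn x => hcmono x hn
  have hM : ∀ k, ∫⁻ ω, (∫⁻ x, G x ∂(M ω)) ^ k ∂P =
      ⨆ n, ∫⁻ ω, (∫⁻ x, (f n x : ℝ≥0∞) ∂(M ω)) ^ k ∂P := fun k => by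
    simp_rw [hI, hpow (hImono _)]
    exact lintegral_iSup (fun n => (hIm n).pow_const k)
      fun n n' hn ω => pow_le_pow_left' (hImono ω hn) k
  have hdmono : ∀ x, Monotone fun n => (f n x : ℝ≥0∞) / ENNReal.ofReal b := fun x n n' hn =>
    ENNReal.div_le_div_right (hcmono x hn) _
  have hJ : ∀ k : ℕ, (k ! : ℝ≥0∞) * ∫⁻ x, (G x / ENNReal.ofReal b) ^ (k + 1) ∂H =
      ⨆ n, (k ! : ℝ≥0∞) * ∫⁻ x, ((f n x : ℝ≥0∞) / ENNReal.ofReal b) ^ (k + 1) ∂H := fun k => by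
    rw [← ENNReal.mul_iSup, ← lintegral_iSup (fun n => ((hfm n).div_const _).pow_const _)
      fun n n' hn x => pow_le_pow_left' (hdmono x hn) _]
    simp_rw [← hpow (hdmono _), ← ENNReal.iSup_div, hsup]
  simp_rw [hM, hJ]
  exact iSup_eq_sum_antidiagonal_choose_mul
    (M := fun n k => ∫⁻ ω, (∫⁻ x, (f n x : ℝ≥0∞) ∂(M ω)) ^ k ∂P)
    (J := fun n k => (k ! : ℝ≥0∞) *
      ∫⁻ x, ((f n x : ℝ≥0∞) / ENNReal.ofReal b) ^ (k + 1) ∂H)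
    (fun k n n' hn => lintegral_mono fun ω => pow_le_pow_left' (hImono ω hn) k)
    (fun k n n' hn => mul_le_mul_right (lintegral_mono fun x =>
      pow_le_pow_left' (hdmono x hn) _) _)
    fun n => h.lintegral_pow_succ_of_mem_BMPlus hb hH (hf n) k

end GammaMoments

/-! ### Invariance of the gamma law. -/

/-- With b = (1-βc)/c, the product of the two arguments on the left is 1 + cf(1 + β/b), and c(1 +
β/b) = 1/b. This identity singles out the rate b. -/
theorem log_one_add_mul_add_log {f β c : ℝ} (hf : 0 ≤ f) (hβ : 0 < β) (hc : 0 < c)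
    (hρ : β * c < 1) :
    Real.log (1 + c * f) + Real.log (1 + β * (c * f / (1 + c * f)) / ((1 - β * c) / c)) =
      Real.log (1 + f / ((1 - β * c) / c)) := by
  have h1 : 0 < 1 - β * c := by linarith
  have h2 : 0 < 1 + c * f := by positivity
  rw [← Real.log_mul h2.ne' (by positivity)]
  have h3 : 1 - c * β ≠ 0 := by linarith
  congr 1
  field_simp
  ring

/-- In the stationary regime the gamma law is invariant under the M-ARG(1) transition. -/
theorem IsMARG.isGammaRandomMeasure {Ω X : Type*} [MeasurableSpace Ω] [PseudoMetricSpace X]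
    [MeasurableSpace X] {P : Measure Ω} [IsProbabilityMeasure P] {H : Measure X} {β c : ℕ → ℝ}
    {W : ℕ → Ω → Measure X} (h : IsMARG P H β c W) {β₀ c₀ : ℝ}
    (hs : IsTimeStationary P H β c W β₀ c₀) {t : ℕ} (ht : 1 ≤ t) :
    IsGammaRandomMeasure P (W t) H ((1 - β₀ * c₀) / c₀) := by
  have hβ : 0 < β₀ := hs.β_const 2 le_rfl ▸ h.β_pos 2 le_rfl
  have hc : 0 < c₀ := hs.c_const 2 le_rfl ▸ h.c_pos 2 le_rfl
  have hρ := hs.rho_lt_one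
  have hb : 0 < (1 - β₀ * c₀) / c₀ := div_pos (by linarith) hc
  induction t, ht using Nat.le_induction with
  | base => exact hs.initial
  | succ t ht ih =>
    refine ⟨h.random (t + 1) (by omega), fun f hf => ?_⟩
    have htr := h.transition t ht f hf
    rw [hs.c_const (t + 1) (by omega), hs.β_const (t + 1) (by omega)] at htr
    rw [← integral_condExp (h.random t ht).measurable.comap_le, integral_congr_ae htr]
    -- The noncentral part of the transition is exp(-∫ g dW_t) with g in BM₊, so the induction
    -- hypothesis evaluates its mean.
    let g : X → ℝ≥0 := fun x =>
      β₀.toNNReal * (c₀.toNNReal * f x / (1 + c₀.toNNReal * f x))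
    have hgx : ∀ x, (g x : ℝ) = β₀ * (c₀ * f x / (1 + c₀ * f x)) := fun x => by
      simp [g, hβ.le, hc.le]
    have hfm := hf.1
    have hg : g ∈ BMPlus X := by
      refine BMPlus.const_mul ⟨by fun_prop, ⟨1, fun x => ?_⟩, hf.2.2.subset fun x hx => ?_⟩ _
      · exact div_le_one_of_le₀ (by simp) (by positivity)
      · intro h0
        simp [h0] at hx
    have hint : ∀ (f : X → ℝ≥0), f ∈ BMPlus X → ∀ s : ℝ, 0 ≤ s →
        Integrable (fun x => Real.log (1 + s * f x)) H := fun f hf s hs =>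
      integrable_log_one_add_mul hf.1.coe_nnreal_real
        (BMPlus.integrable hf h.base_locFinite) (fun x => (f x).coe_nonneg) hs
    have hnc : ∀ ω, ncGammaLaplace H (ENNReal.ofReal β₀ • W t ω) c₀ f =
        Real.exp (-∫ x, Real.log (1 + c₀ * f x) ∂H) *
          Real.exp (-∫ x, (g x : ℝ) ∂(W t ω)) := fun ω => by
      simp only [ncGammaLaplace, hgx]
      rw [← Real.exp_add, integral_smul_measure, ENNReal.toReal_ofReal hβ.le,
        integral_const_mul, smul_eq_mul, sub_eq_add_neg]
    simp_rw [hnc]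
    have hgi := hint g hg ((1 - β₀ * c₀) / c₀)⁻¹ (inv_nonneg.2 hb.le)
    simp_rw [inv_mul_eq_div] at hgi
    rw [integral_const_mul, ih.laplace g hg, ← Real.exp_add, ← neg_add,
      ← integral_add (hint f hf c₀ hc.le) hgi]
    congr 2
    refine integral_congr_ae (ae_of_all _ fun x => ?_)
    dsimp only
    rw [hgx]
    exact log_one_add_mul_add_log (f x).coe_nonneg hβ hc hρ

/-! ### Complete Bell polynomials solve the recursion. -/

section BellRecursion

/-- Vectors `(l_1, …, l_N)` of nonnegative integers with `∑ r l_r = n`. -/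
def weightedVectors (N n : ℕ) : Finset (Fin N → ℕ) :=
  (Fintype.piFinset fun _ => Finset.range (n + 1)).filter
    fun l => ∑ i : Fin N, ((i : ℕ) + 1) * l i = n

theorem mem_weightedVectors {N n : ℕ} {l : Fin N → ℕ} :
    l ∈ weightedVectors N n ↔ ∑ i : Fin N, ((i : ℕ) + 1) * l i = n := by
  simp only [weightedVectors, Finset.mem_filter, Fintype.mem_piFinset, Finset.mem_range,
    and_iff_right_iff_imp]
  intro h i
  have h1 : ((i : ℕ) + 1) * l i ≤ ∑ i : Fin N, ((i : ℕ) + 1) * l i :=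
    Finset.single_le_sum (f := fun i : Fin N => ((i : ℕ) + 1) * l i)
      (fun _ _ => Nat.zero_le _) (Finset.mem_univ i)
  nlinarith [Nat.zero_le ((i : ℕ) * l i)]

theorem mul_le_of_mem_weightedVectors {N n : ℕ} {l : Fin N → ℕ} (hl : l ∈ weightedVectors N n)
    (i : Fin N) : ((i : ℕ) + 1) * l i ≤ n := by
  rw [← mem_weightedVectors.1 hl]
  exact Finset.single_le_sum (f := fun i : Fin N => ((i : ℕ) + 1) * l i)
    (fun _ _ => Nat.zero_le _) (Finset.mem_univ i)

/-- The factor `x_r ^ a / (r! ^ a a!)` for `r = i + 1`. -/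
noncomputable def bellFactor (x : ℕ → ℝ≥0∞) (i a : ℕ) : ℝ≥0∞ :=
  x (i + 1) ^ a * (((i + 1)! ^ a * a ! : ℕ) : ℝ≥0∞)⁻¹

@[simp]
theorem bellFactor_zero (x : ℕ → ℝ≥0∞) (i : ℕ) : bellFactor x i 0 = 1 := by
  simp [bellFactor]

theorem natCast_mul_inv_natCast_mul {p : ℕ} (hp : p ≠ 0) (q : ℕ) :
    (p : ℝ≥0∞) * ((p * q : ℕ) : ℝ≥0∞)⁻¹ = (q : ℝ≥0∞)⁻¹ := by
  rw [Nat.cast_mul, ENNReal.mul_inv (Or.inl (by exact_mod_cast hp)) (by simp), ← mul_assoc,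
    ENNReal.mul_inv_cancel (by exact_mod_cast hp) (by simp), one_mul]

theorem mul_bellFactor_succ (x : ℕ → ℝ≥0∞) (i a : ℕ) :
    (((i + 1) * (a + 1) : ℕ) : ℝ≥0∞) * bellFactor x i (a + 1) =
      x (i + 1) * (i ! : ℝ≥0∞)⁻¹ * bellFactor x i a := by
  have h1 : (i + 1)! ^ (a + 1) * (a + 1)! =
      ((i + 1) * (a + 1)) * (i ! * ((i + 1)! ^ a * a !)) := by
    rw [Nat.factorial_succ a, pow_succ, Nat.factorial_succ i]
    ring
  rw [bellFactor, h1, mul_left_comm, natCast_mul_inv_natCast_mul (by positivity), Nat.cast_mul,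
    ENNReal.mul_inv (Or.inl (by exact_mod_cast Nat.factorial_ne_zero i))
      (Or.inl (ENNReal.natCast_ne_top _)), bellFactor, pow_succ]
  ring

/-- `∑ ∏ x_r ^ l_r / (r! ^ l_r l_r!)` over the vectors with `N` entries and `∑ r l_r = n`. -/
noncomputable def bellSum (x : ℕ → ℝ≥0∞) (N n : ℕ) : ℝ≥0∞ :=
  ∑ l ∈ weightedVectors N n, ∏ i : Fin N, bellFactor x i (l i)

/-- Adding 1 to entry i is a bijection from vectors of weight n-(i+1) onto those of weight n with
l_i ≥ 1; the others contribute zero. -/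
theorem sum_weightedVectors_mul (x : ℕ → ℝ≥0∞) {N n : ℕ} (i : Fin N) (hi : (i : ℕ) + 1 ≤ n) :
    ∑ l ∈ weightedVectors N n,
        ((((i : ℕ) + 1) * l i : ℕ) : ℝ≥0∞) * ∏ k : Fin N, bellFactor x k (l k) =
      x (i + 1) * ((i : ℕ)! : ℝ≥0∞)⁻¹ * bellSum x N (n - (i + 1)) := by
  have hinj : Function.Injective fun l : Fin N → ℕ => l + Pi.single i 1 :=
    add_left_injective _
  have hsum : ∀ l : Fin N → ℕ, ∑ k : Fin N, ((k : ℕ) + 1) * (l + Pi.single i 1 : Fin N → ℕ) k =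
      (∑ k : Fin N, ((k : ℕ) + 1) * l k) + (i + 1) := fun l => by
    simp [mul_add, Finset.sum_add_distrib, Pi.single_apply]
  have hsub : (weightedVectors N (n - (i + 1))).map ⟨_, hinj⟩ ⊆ weightedVectors N n := by
    intro l hl
    obtain ⟨l', hl', rfl⟩ := Finset.mem_map.1 hl
    rw [mem_weightedVectors] at hl' ⊢
    exact (hsum l').trans (by omega)
  rw [← Finset.sum_subset hsub, Finset.sum_map, bellSum, Finset.mul_sum]
  · refine Finset.sum_congr rfl fun l _ => ?_
    simp only [Function.Embedding.coeFn_mk]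
    rw [← Finset.mul_prod_erase _ _ (Finset.mem_univ i),
      ← Finset.mul_prod_erase _ _ (Finset.mem_univ i), ← mul_assoc, ← mul_assoc]
    congr 1
    · simpa using mul_bellFactor_succ x i (l i)
    · refine Finset.prod_congr rfl fun k hk => ?_
      simp [Pi.single_eq_of_ne (Finset.ne_of_mem_erase hk)]
  · intro l hl hl'
    have h0 : l i = 0 := by
      by_contra h0
      have hadd : l - Pi.single i 1 + Pi.single i 1 = l := by
        ext k
        rcases eq_or_ne k i with rfl | hk
        · simp; omega
        · simp [Pi.single_eq_of_ne hk]
      refine hl' (Finset.mem_map.2 ⟨l - Pi.single i 1, ?_, hadd⟩)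
      have h1 := hsum (l - Pi.single i 1)
      rw [hadd, mem_weightedVectors.1 hl] at h1
      rw [mem_weightedVectors]
      omega
    simp [h0]

/-- Euler's argument for weighted homogeneous polynomials: insert n = ∑ r l_r in each term and
exchange the sums. -/
theorem natCast_mul_bellSum (x : ℕ → ℝ≥0∞) {n : ℕ} :
    (n : ℝ≥0∞) * bellSum x n n =
      ∑ i : Fin n, x (i + 1) * ((i : ℕ)! : ℝ≥0∞)⁻¹ * bellSum x n (n - (i + 1)) := by
  rw [← Finset.sum_congr rfl fun i _ => sum_weightedVectors_mul x i i.2, Finset.sum_comm, bellSum,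
    Finset.mul_sum]
  refine Finset.sum_congr rfl fun l hl => ?_
  rw [← Finset.sum_mul, ← Nat.cast_sum, mem_weightedVectors.1 hl]

/-- An entry of index r > n must vanish. This is needed because the recursion lowers the weight but
keeps the length of the vectors. -/
theorem bellSum_succ_left (x : ℕ → ℝ≥0∞) {N n : ℕ} (h : n ≤ N) :
    bellSum x (N + 1) n = bellSum x N n := by
  have hinj : Function.Injective fun l : Fin N → ℕ => (Fin.snoc l 0 : Fin (N + 1) → ℕ) :=
    fun l l' hl => by simpa using congrArg Fin.init hl
  have hmap : weightedVectors (N + 1) n = (weightedVectors N n).map ⟨_, hinj⟩ := by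
    ext l
    rw [Finset.mem_map]
    constructor
    · intro hl
      have h0 : l (Fin.last N) = 0 := by
        have h1 := mul_le_of_mem_weightedVectors hl (Fin.last N)
        by_contra h0
        have h2 : 1 ≤ l (Fin.last N) := Nat.one_le_iff_ne_zero.2 h0
        rw [Fin.val_last] at h1
        nlinarith
      have hl' : (Fin.snoc (Fin.init l) 0 : Fin (N + 1) → ℕ) = l := by
        rw [← h0, Fin.snoc_init_self]
      refine ⟨Fin.init l, ?_, hl'⟩
      rw [mem_weightedVectors, Fin.sum_univ_castSucc, h0] at hl
      simpa [mem_weightedVectors, Fin.init] using hl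
    · rintro ⟨l', hl', rfl⟩
      rw [mem_weightedVectors] at hl' ⊢
      simpa [Fin.sum_univ_castSucc] using hl'
  rw [bellSum, hmap, Finset.sum_map, bellSum]
  refine Finset.sum_congr rfl fun l _ => ?_
  simp [Fin.prod_univ_castSucc]

theorem bellSum_eq_of_le (x : ℕ → ℝ≥0∞) {N n : ℕ} (h : n ≤ N) :
    bellSum x N n = bellSum x n n := by
  induction N, h using Nat.le_induction with
  | base => rfl
  | succ N h ih => rw [bellSum_succ_left x h, ih]

theorem natCast_choose_mul_factorial {a j k : ℕ} (h : a + j = k) :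
    (k.choose a : ℝ≥0∞) * (a ! : ℝ≥0∞) = (k ! : ℝ≥0∞) * (j ! : ℝ≥0∞)⁻¹ := by
  subst h
  rw [← Nat.choose_mul_factorial_mul_factorial (Nat.le_add_right a j), Nat.add_sub_cancel_left,
    Nat.cast_mul, Nat.cast_mul, mul_assoc _ _ (_⁻¹),
    ENNReal.mul_inv_cancel (by exact_mod_cast (Nat.factorial_ne_zero j)) (by simp), mul_one]

/-- The recursion between moments and cumulants is solved by the complete Bell polynomials. -/
theorem eq_factorial_mul_bellSum {M x : ℕ → ℝ≥0∞} (h0 : M 0 = 1)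
    (h : ∀ k, M (k + 1) = ∑ ij ∈ Finset.HasAntidiagonal.antidiagonal k,
      (k.choose ij.1 : ℝ≥0∞) * (M ij.1 * x (ij.2 + 1))) (n : ℕ) :
    M n = (n ! : ℝ≥0∞) * bellSum x n n := by
  induction n using Nat.strong_induction_on with
  | _ n ih =>
    cases n with
    | zero => simp [h0, bellSum, weightedVectors]
    | succ k =>
      have h1 := natCast_mul_bellSum x (n := k + 1)
      rw [Fin.sum_univ_eq_sum_range
        (fun i => x (i + 1) * (i ! : ℝ≥0∞)⁻¹ * bellSum x (k + 1) (k + 1 - (i + 1)))] at h1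
      -- The factor k+1 of (k+1)! feeds the Euler identity; the antidiagonal is reversed so that i
      -- indexes the cumulant.
      rw [Nat.factorial_succ, Nat.cast_mul, mul_comm (((k + 1 : ℕ)) : ℝ≥0∞), mul_assoc, h1, h,
        ← Finset.Nat.sum_antidiagonal_swap, Finset.Nat.sum_antidiagonal_eq_sum_range_succ_mk,
        Finset.mul_sum]
      refine Finset.sum_congr rfl fun i hi => ?_
      have hik : i ≤ k := Nat.lt_succ_iff.1 (Finset.mem_range.1 hi)
      simp only [Prod.swap]
      rw [ih (k - i) (by omega), Nat.add_sub_add_right, bellSum_eq_of_le x (by omega : k - i ≤ k + 1),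
        mul_assoc ((k - i)! : ℝ≥0∞), ← mul_assoc (k.choose (k - i) : ℝ≥0∞),
        natCast_choose_mul_factorial (Nat.sub_add_cancel hik)]
      ring

theorem factorial_mul_bellSum_eq_sum_partitionVectors (x : ℕ → ℝ≥0∞) (j : ℕ) :
    (j ! : ℝ≥0∞) * bellSum x j j = ∑ l ∈ partitionVectors j,
      partitionCoeff l * ∏ i : Fin j, x ((i : ℕ) + 1) ^ l i := by
  rw [bellSum, Finset.mul_sum]
  refine Finset.sum_congr rfl fun l _ => ?_
  simp only [bellFactor]
  rw [Finset.prod_mul_distrib, ← ENNReal.prod_inv_distrib, partitionCoeff]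
  · push_cast
    ring
  · intro i _ k _ _
    exact Or.inl (by positivity)

end BellRecursion

/-! ### Shot noise intensity and conclusion. -/

theorem BoundedlyFinite.sigmaFinite {X : Type*} [PseudoMetricSpace X] [SecondCountableTopology X]
    [MeasurableSpace X] {μ : Measure X} (hμ : BoundedlyFinite μ) : SigmaFinite μ :=
  have : IsLocallyFiniteMeasure μ :=
    ⟨fun x => ⟨Metric.ball x 1, Metric.ball_mem_nhds x one_pos, hμ _ Metric.isBounded_ball⟩⟩
  inferInstance

theorem measurable_setLIntegral_kernel {Y X : Type*} [MeasurableSpace Y] [MeasurableSpace X]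
    {ℓ : Measure Y} [SFinite ℓ] {K : Y → X → ℝ≥0} (hK : Measurable (Function.uncurry K))
    (B : Set Y) : Measurable fun θ => ∫⁻ y in B, (K y θ : ℝ≥0∞) ∂ℓ :=
  Measurable.lintegral_prod_left' (f := fun p : Y × X => (K p.1 p.2 : ℝ≥0∞))
    hK.coe_nnreal_ennreal

theorem shotNoiseIntensity_apply {Y X : Type*} [MeasurableSpace Y] [MeasurableSpace X]
    {ℓ : Measure Y} [SFinite ℓ] {K : Y → X → ℝ≥0} (hK : Measurable (Function.uncurry K))
    (k : ℝ≥0) {w : Measure X} [SFinite w] {B : Set Y} (hB : MeasurableSet B) :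
    shotNoiseIntensity ℓ K k w B = k * ∫⁻ θ, (∫⁻ y in B, (K y θ : ℝ≥0∞) ∂ℓ) ∂w := by
  rw [shotNoiseIntensity, Measure.smul_apply, withDensity_apply _ hB, smul_eq_mul,
    lintegral_lintegral_swap]
  exact hK.coe_nnreal_ennreal.aemeasurable

/-- Identifies J_{k+1} with the cumulant in the gamma recursion, using Γ(k+1) = k!. -/
theorem momentJ_succ {Y X : Type*} [MeasurableSpace Y] [MeasurableSpace X] {H : Measure X}
    {ℓ : Measure Y} [SFinite ℓ] {K : Y → X → ℝ≥0} (hK : Measurable (Function.uncurry K))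
    {β c : ℝ} (hc : 0 < c) (hρ : β * c < 1) (B : Set Y) (k : ℕ) :
    momentJ H ℓ K β c B (k + 1) = (k ! : ℝ≥0∞) * ∫⁻ θ,
      ((∫⁻ y in B, (K y θ : ℝ≥0∞) ∂ℓ) / ENNReal.ofReal ((1 - β * c) / c)) ^ (k + 1) ∂H := by
  have hb : 0 < (1 - β * c) / c := div_pos (by linarith) hc
  have h1 : ∀ a : ℝ≥0∞, (a / ENNReal.ofReal ((1 - β * c) / c)) ^ (k + 1) =
      ENNReal.ofReal ((c / (1 - β * c)) ^ (k + 1)) * a ^ (k + 1) := fun a => by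
    rw [div_eq_mul_inv, ← ENNReal.ofReal_inv_of_pos hb, inv_div, mul_pow, mul_comm,
      ENNReal.ofReal_pow (div_nonneg hc.le (by linarith))]
  simp_rw [h1]
  rw [lintegral_const_mul _ ((measurable_setLIntegral_kernel hK B).pow_const _), ← mul_assoc,
    ← ENNReal.ofReal_natCast, ← ENNReal.ofReal_mul (by positivity), momentJ, Nat.cast_add_one,
    Real.Gamma_nat_eq_factorial, div_pow, mul_div_assoc]

theorem proposition10 {Ω Θ Y : Type*} [MeasurableSpace Ω]
    [MetricSpace Θ] [PolishSpace Θ] [MeasurableSpace Θ] [BorelSpace Θ] [MeasurableSpace Y]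
    (P : Measure Ω) [IsProbabilityMeasure P]
    (H : Measure Θ) (β c : ℕ → ℝ) (ℓ : Measure Y) [SigmaFinite ℓ]
    (K : Y → Θ → ℝ≥0) (κ : ℕ → ℝ≥0)
    (W : ℕ → Ω → Measure Θ) (N : ℕ → Ω → Measure Y)
    (hN : IsSNMARG P H β c ℓ K κ W N)
    (β₀ c₀ : ℝ) (hstat : IsTimeStationary P H β c W β₀ c₀)
    (B : Set Y) (hB : MeasurableSet B) (m : ℕ) (hm : 1 ≤ m)
    (hJ : ∀ r ∈ Finset.Icc 1 m, momentJ H ℓ K β₀ c₀ B r < ∞)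
    (t : ℕ) (ht : 1 ≤ t) :
    ∫⁻ ω, (N t ω B) ^ m ∂P =
      ∑ j ∈ Finset.Icc 1 m, (Nat.stirlingSecond m j : ℝ≥0∞) * (κ t : ℝ≥0∞) ^ j *
        ∑ l ∈ partitionVectors j,
          partitionCoeff l * ∏ i : Fin j, momentJ H ℓ K β₀ c₀ B ((i : ℕ) + 1) ^ l i := by
  obtain ⟨hM, hK, hpois⟩ := hN
  have hc : 0 < c₀ := hstat.c_const 2 le_rfl ▸ hM.c_pos 2 le_rfl
  have hρ := hstat.rho_lt_one
  have hb : 0 < (1 - β₀ * c₀) / c₀ := div_pos (by linarith) hc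
  have hgam := hM.isGammaRandomMeasure hstat ht
  have hGm := measurable_setLIntegral_kernel (ℓ := ℓ) hK B
  set G : Θ → ℝ≥0∞ := fun θ => ∫⁻ y in B, (K y θ : ℝ≥0∞) ∂ℓ with hG
  set J : ℕ → ℝ≥0∞ := momentJ H ℓ K β₀ c₀ B with hJdef
  have hrec : ∀ k, ∫⁻ ω, (∫⁻ θ, G θ ∂(W t ω)) ^ (k + 1) ∂P =
      ∑ ij ∈ Finset.HasAntidiagonal.antidiagonal k, (k.choose ij.1 : ℝ≥0∞) *
        ((∫⁻ ω, (∫⁻ θ, G θ ∂(W t ω)) ^ ij.1 ∂P) * J (ij.2 + 1)) := fun k => by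
    simp_rw [hJdef, momentJ_succ hK hc hρ]
    exact hgam.lintegral_pow_succ hb hM.base_locFinite hGm k
  have hmom : ∀ j, ∫⁻ ω, (∫⁻ θ, G θ ∂(W t ω)) ^ j ∂P =
      ∑ l ∈ partitionVectors j, partitionCoeff l * ∏ i : Fin j, J ((i : ℕ) + 1) ^ l i := fun j => by
    rw [← factorial_mul_bellSum_eq_sum_partitionVectors]
    exact eq_factorial_mul_bellSum (M := fun j => ∫⁻ ω, (∫⁻ θ, G θ ∂(W t ω)) ^ j ∂P) (by simp) hrec j
  have hXm : Measurable fun ω => ∫⁻ θ, G θ ∂(W t ω) :=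
    (Measure.measurable_lintegral hGm).comp hgam.random.measurable
  -- The recursion at k = 0 reads E X = J_1 < ∞, so X is a.s. finite and the infinite branch of
  -- `poissonLaw` is avoided.
  have hX1 : ∫⁻ ω, ∫⁻ θ, G θ ∂(W t ω) ∂P ≠ ∞ := by
    have h1 : ∫⁻ ω, ∫⁻ θ, G θ ∂(W t ω) ∂P = J 1 := by simpa using hrec 0
    rw [h1]
    exact (hJ 1 (Finset.mem_Icc.2 ⟨le_rfl, hm⟩)).ne
  have hΛ : ∀ᵐ ω ∂P, shotNoiseIntensity ℓ K (κ t) (W t ω) B = κ t * ∫⁻ θ, G θ ∂(W t ω) := by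
    filter_upwards [hgam.random.locFinite] with ω hω
    have := hω.sigmaFinite
    exact shotNoiseIntensity_apply hK (κ t) hB
  have hfin : ∀ᵐ ω ∂P, shotNoiseIntensity ℓ K (κ t) (W t ω) B ≠ ∞ := by
    filter_upwards [hΛ, ae_lt_top hXm hX1] with ω h1 h2
    rw [h1]
    exact ENNReal.mul_ne_top ENNReal.coe_ne_top h2.ne
  rw [(hpois t ht).lintegral_pow hgam.random.measurable.comap_le hB hfin m]
  calc _ = ∫⁻ ω, ∑ j ∈ Finset.range (m + 1), (Nat.stirlingSecond m j : ℝ≥0∞) *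
          (κ t : ℝ≥0∞) ^ j * (∫⁻ θ, G θ ∂(W t ω)) ^ j ∂P := by
        refine lintegral_congr_ae ?_
        filter_upwards [hΛ] with ω hω
        simp_rw [hω, mul_pow, mul_assoc]
    _ = ∑ j ∈ Finset.range (m + 1), (Nat.stirlingSecond m j : ℝ≥0∞) *
          (κ t : ℝ≥0∞) ^ j * ∫⁻ ω, (∫⁻ θ, G θ ∂(W t ω)) ^ j ∂P := by
        rw [lintegral_finsetSum _ fun j _ => (hXm.pow_const j).const_mul _]
        exact Finset.sum_congr rfl fun j _ => lintegral_const_mul _ (hXm.pow_const j)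
    _ = ∑ j ∈ Finset.Icc 1 m, (Nat.stirlingSecond m j : ℝ≥0∞) *
          (κ t : ℝ≥0∞) ^ j * ∫⁻ ω, (∫⁻ θ, G θ ∂(W t ω)) ^ j ∂P := by
        refine (Finset.sum_subset (fun j hj => ?_) fun j _ hj => ?_).symm
        · simp only [Finset.mem_Icc, Finset.mem_range] at hj ⊢
          omega
        -- The extra term vanishes since S(m,0) = 0 for m ≥ 1.
        · obtain rfl : j = 0 := by
            simp only [Finset.mem_Icc, Finset.mem_range] at *
            omega
          obtain ⟨m, rfl⟩ := Nat.exists_eq_add_of_le' hm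
          simp
    _ = _ := by simp_rw [hmom]
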